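/- All groups are finite. Let $\sigma=\{\sigma_i\mid i\in I\}$ be a partition of the set of all primes. For $\pi$ a set of primes, a $\pi$-group is a group $G$ all of whose order's prime divisors lie in $\pi$; $\mathfrak{G}_{\pi}$ is the class of all $\pi$-groups; $\pi'$ is the complement of $\pi$; $O_{\pi}(G)$ is the largest normal $\pi$-subgroup of $G$, and $O_{\pi',\pi}(G)$ is defined by $O_{\pi',\pi}(G)/O_{\pi'}(G)=O_{\pi}(G/O_{\pi'}(G))$. For a natural number $n\ge 1$ let $\sigma(n)$ be the set of all $\sigma_i$ that contain a prime divisor of $n$, and let $\sigma(G)=\sigma(|G|)$; $n$ and $m$ are $\sigma$-coprime if $\sigma(n)\cap\sigma(m)=\emptyset$. A group $G$ is $\sigma$-soluble if every chief factor of $G$ is a $\sigma_i$-group for some $i$ (depending on the factor). A class of groups is closed under isomorphism and may be empty. A class $\mathfrak{X}$ is a formation if $G\in\mathfrak{X}$ and $N\trianglelefteq G$ imply $G/N\in\mathfrak{X}$, and $G/N,\,G/R\in\mathfrak{X}$ with $N,R\trianglelefteq G$ imply $G/(N\cap R)\in\mathfrak{X}$. For classes $\mathfrak{M},\mathfrak{H}$,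 the class $\mathfrak{M}\mathfrak{H}$ consists of all groups $G$ with a normal subgroup $N\in\mathfrak{M}$ such that $G/N\in\mathfrak{H}$. For $t>1$, a class $\mathfrak{X}$ is $\Sigma_t^{\sigma}$-closed if it contains every group $G$ that has subgroups $A_1,\dots,A_t\in\mathfrak{X}$ whose indices $|G:A_1|,\dots,|G:A_t|$ are pairwise $\sigma$-coprime. A formation $\sigma$-function is a function $f$ assigning a formation $f(\sigma_i)$ to each $\sigma_i\in\sigma$, and $LF_{\sigma}(f)$ is the class of all groups $G$ such that $G=1$, or $G\neq 1$ and $G/O_{\sigma_i',\sigma_i}(G)\in f(\sigma_i)$ for all $\sigma_i\in\sigma(G)$. The function $f$ is integrated if $f(\sigma_i)\subseteq LF_{\sigma}(f)$ for all $i$, and full if $f(\sigma_i)=\mathfrak{G}_{\sigma_i}f(\sigma_i)$ for all $i$. If $F$ is an integrated and full formation $\sigma$-function with $\mathfrak{F}=LF_{\sigma}(F)$, then $F$ is called the canonical $\sigma$-local definition of $\mathfrak{F}$. **Theorem 3.5.** Let $t>1$ be a natural number and let $\mathfrak{F}=LF_{\sigma}(F)$ be a class all of whose members are $\sigma$-soluble,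 where $F$ is the canonical $\sigma$-local definition of $\mathfrak{F}$. If $F(\sigma_i)$ is $\Sigma_t^{\sigma}$-closed for every $i$, then $\mathfrak{F}$ is $\Sigma_{t+1}^{\sigma}$-closed. -/

import Mathlib

universe u v

namespace SigmaFormation

/-! ### Sets of primes, blocks of a partition -/

/-- `n` is a `π`-number: all prime divisors of `n` lie in `π`. -/
def IsPiNumber (π : Set Nat.Primes) (n : ℕ) : Prop :=
  ∀ p : Nat.Primes, (p : ℕ) ∣ n → p ∈ π

/-- `G` is a `π`-group: all prime divisors of `|G|` lie in `π`. -/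
def IsPiGroup (π : Set Nat.Primes) (G : Type u) [Group G] : Prop :=
  IsPiNumber π (Nat.card G)

/-- `σ(n)`: the blocks of `σ` that contain a prime divisor of `n`. -/
def sigmaOf (σ : Set (Set Nat.Primes)) (n : ℕ) : Set (Set Nat.Primes) :=
  {s | s ∈ σ ∧ ∃ p ∈ s, (p : ℕ) ∣ n}

/-- `n` and `m` are `σ`-coprime: `σ(n) ∩ σ(m) = ∅`. -/
def SigmaCoprime (σ : Set (Set Nat.Primes)) (n m : ℕ) : Prop :=
  sigmaOf σ n ∩ sigmaOf σ m = ∅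

/-! ### `σ`-primary and `σ`-soluble groups -/

/-- `G` is `σ`-primary: a `σ_i`-group for some block `σ_i`. -/
def IsSigmaPrimary (σ : Set (Set Nat.Primes)) (G : Type u) [Group G] : Prop :=
  ∃ s ∈ σ, IsPiGroup s G

/-- `H / K` is a chief factor of `G`: `K < H` are normal in `G` and no normal subgroup of `G`
lies strictly between them. -/
def IsChiefFactor {G : Type u} [Group G] (K H : Subgroup G) : Prop :=
  K.Normal ∧ H.Normal ∧ K < H ∧ ∀ N : Subgroup G, N.Normal → K ≤ N → N ≤ H → N = K ∨ N = H

/-- `G` is `σ`-soluble: every chief factor of `G` is `σ`-primary. -/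
def IsSigmaSoluble (σ : Set (Set Nat.Primes)) (G : Type u) [Group G] : Prop :=
  ∀ (K H : Subgroup G) [K.Normal], IsChiefFactor K H → IsSigmaPrimary σ (H ⧸ K.subgroupOf H)

/-! ### The subgroups `O_π(G)` and `O_{π', π}(G)` -/

/-- `O_π(G)`: the product (join) of all normal `π`-subgroups of `G`. -/
def piCore (π : Set Nat.Primes) (G : Type u) [Group G] : Subgroup G :=
  sSup {N : Subgroup G | N.Normal ∧ IsPiGroup π N}

theorem piCore_map_le (π : Set Nat.Primes) {G : Type u} {H : Type v} [Group G] [Group H]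
    (e : G ≃* H) : (piCore π G).map e.toMonoidHom ≤ piCore π H := by
  rw [Subgroup.map_le_iff_le_comap]
  refine sSup_le ?_
  rintro N ⟨hN, hπ⟩
  rw [← Subgroup.map_le_iff_le_comap]
  refine le_sSup ⟨hN.map _ e.surjective, ?_⟩
  have h : Nat.card (N.map e.toMonoidHom) = Nat.card N :=
    (Nat.card_congr (N.equivMapOfInjective e.toMonoidHom e.injective).toEquiv).symm
  unfold IsPiGroup at *
  rwa [h]

theorem piCore_map (π : Set Nat.Primes) {G : Type u} {H : Type v} [Group G] [Group H]
    (e : G ≃* H) : (piCore π G).map e.toMonoidHom = piCore π H := by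
  refine le_antisymm (piCore_map_le π e) fun y hy => ?_
  exact ⟨e.symm y, piCore_map_le π e.symm ⟨y, hy, rfl⟩, e.apply_symm_apply y⟩

instance piCore_normal (π : Set Nat.Primes) (G : Type u) [Group G] : (piCore π G).Normal := by
  refine ⟨fun n hn g => ?_⟩
  exact piCore_map_le π (MulAut.conj g) ⟨n, hn, rfl⟩

/-- `O_{π', π}(G)`: the full preimage in `G` of `O_π(G / O_{π'}(G))`. -/
def piPrimePiCore (π : Set Nat.Primes) (G : Type u) [Group G] : Subgroup G :=
  (piCore π (G ⧸ piCore πᶜ G)).comap (QuotientGroup.mk' (piCore πᶜ G))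

instance piPrimePiCore_normal (π : Set Nat.Primes) (G : Type u) [Group G] :
    (piPrimePiCore π G).Normal := by
  unfold piPrimePiCore
  infer_instance

theorem piPrimePiCore_map_le (π : Set Nat.Primes) {G : Type u} {H : Type v} [Group G] [Group H]
    (e : G ≃* H) : (piPrimePiCore π G).map e.toMonoidHom ≤ piPrimePiCore π H := by
  rintro _ ⟨x, hx, rfl⟩
  exact piCore_map_le π (QuotientGroup.congr _ _ e (piCore_map πᶜ e)) ⟨_, hx, rfl⟩

theorem piPrimePiCore_map (π : Set Nat.Primes) {G : Type u} {H : Type v} [Group G] [Group H]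
    (e : G ≃* H) : (piPrimePiCore π G).map e.toMonoidHom = piPrimePiCore π H := by
  refine le_antisymm (piPrimePiCore_map_le π e) fun y hy => ?_
  exact ⟨e.symm y, piPrimePiCore_map_le π e.symm ⟨y, hy, rfl⟩, e.apply_symm_apply y⟩

/-! ### Classes of finite groups and formations -/

/-- A class of finite groups: a property of finite groups that is invariant under isomorphism.
The empty class is allowed. -/
@[ext]
structure GroupClass where
  /-- Membership of a finite group in the class. -/
  Mem : (G : Type u) → [Group G] → [Finite G] → Prop
  iso : ∀ {G H : Type u} [Group G] [Finite G] [Group H] [Finite H], G ≃* H → Mem G → Mem H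

/-- A formation: a class closed under quotients and under subdirect products. -/
def IsFormation (X : GroupClass.{u}) : Prop :=
  (∀ (G : Type u) [Group G] [Finite G] (N : Subgroup G) [N.Normal], X.Mem G → X.Mem (G ⧸ N)) ∧
  (∀ (G : Type u) [Group G] [Finite G] (N R : Subgroup G) [N.Normal] [R.Normal],
    X.Mem (G ⧸ N) → X.Mem (G ⧸ R) → X.Mem (G ⧸ (N ⊓ R)))

/-- Inclusion of classes. -/
def IsSubclass (X Y : GroupClass.{u}) : Prop :=
  ∀ (G : Type u) [Group G] [Finite G], X.Mem G → Y.Mem G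

/-- The class `𝔊_π` of all finite `π`-groups. -/
def piGroups (π : Set Nat.Primes) : GroupClass.{u} where
  Mem G _ _ := IsPiGroup π G
  iso e h := by
    unfold IsPiGroup at *
    rwa [← Nat.card_congr e.toEquiv]

/-- The product `MX`: the groups `G` with a normal subgroup `N` such that `N ∈ M` and
`G / N ∈ X`. -/
def classMul (M X : GroupClass.{u}) : GroupClass.{u} where
  Mem G _ _ := ∃ (N : Subgroup G) (_ : N.Normal), M.Mem N ∧ X.Mem (G ⧸ N)
  iso {G H} _ _ _ _ e := by
    rintro ⟨N, hN, hM, hX⟩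
    have hN' : (N.map e.toMonoidHom).Normal := hN.map _ e.surjective
    exact ⟨N.map e.toMonoidHom, hN',
      M.iso (N.equivMapOfInjective e.toMonoidHom e.injective) hM,
      X.iso (QuotientGroup.congr N (N.map e.toMonoidHom) e rfl) hX⟩

/-- `X` is `Σ_t^σ`-closed: it contains every finite group `G` that has subgroups
`A_1, …, A_t ∈ X` with pairwise `σ`-coprime indices. -/
def IsSigmaClosed (σ : Set (Set Nat.Primes)) (t : ℕ) (X : GroupClass.{u}) : Prop :=
  ∀ (G : Type u) [Group G] [Finite G] (A : Fin t → Subgroup G),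
    (∀ i, X.Mem (A i)) → (∀ i j, i ≠ j → SigmaCoprime σ (A i).index (A j).index) → X.Mem G

/-! ### `σ`-local formations -/

/-- The class `LF_σ(f)`: the groups `G` such that `G = 1`, or `G ≠ 1` and
`G / O_{σ_i', σ_i}(G) ∈ f(σ_i)` for all `σ_i ∈ σ(G)`. -/
def LF (σ : Set (Set Nat.Primes)) (f : σ → GroupClass.{u}) : GroupClass.{u} where
  Mem G _ _ := Subsingleton G ∨ (Nontrivial G ∧
    ∀ s : σ, (s : Set Nat.Primes) ∈ sigmaOf σ (Nat.card G) →
      (f s).Mem (G ⧸ piPrimePiCore (s : Set Nat.Primes) G))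
  iso {G H} _ _ _ _ e := by
    rintro (h | ⟨h, hf⟩)
    · exact Or.inl e.symm.toEquiv.subsingleton
    · refine Or.inr ⟨e.symm.toEquiv.nontrivial, fun s hs => ?_⟩
      rw [← Nat.card_congr e.toEquiv] at hs
      exact (f s).iso (QuotientGroup.congr _ _ e (piPrimePiCore_map _ e)) (hf s hs)

/-- `f` is a formation `σ`-function: every value `f(σ_i)` is a formation. -/
def IsFormationFunction (σ : Set (Set Nat.Primes)) (f : σ → GroupClass.{u}) : Prop :=
  ∀ s, IsFormation (f s)

/-- `f` is integrated: `f(σ_i) ⊆ LF_σ(f)` for all `i`. -/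
def IsIntegrated (σ : Set (Set Nat.Primes)) (f : σ → GroupClass.{u}) : Prop :=
  ∀ s, IsSubclass (f s) (LF σ f)

/-- `f` is full: `f(σ_i) = 𝔊_{σ_i} f(σ_i)` for all `i`. -/
def IsFull (σ : Set (Set Nat.Primes)) (f : σ → GroupClass.{u}) : Prop :=
  ∀ s : σ, f s = classMul (piGroups (s : Set Nat.Primes)) (f s)

/-- `F` is the canonical `σ`-local definition of `X`: an integrated and full formation
`σ`-function with `X = LF_σ(F)`. -/
def IsCanonicalDefinition (σ : Set (Set Nat.Primes)) (F : σ → GroupClass.{u})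
    (X : GroupClass.{u}) : Prop :=
  IsFormationFunction σ F ∧ X = LF σ F ∧ IsIntegrated σ F ∧ IsFull σ F

end SigmaFormation

namespace SigmaFormation

/-! ### `π`-numbers -/

/-! Induction on |G|: σ-coprimality of the indices and membership in `LF σ F` pass to quotients, so
every proper quotient of G lies in the class. Fix a block s meeting |G|. If O_{s'}(G) ≠ 1, the
condition at s is inherited from G/O_{s'}(G).

Suppose O_{s'}(G) = 1. As t + 1 ≥ 3, three of the given σ-soluble subgroups produce a block r with
O_r(G) ≠ 1 (`exists_piCore_ne_bot`), and r = s, since otherwise O_r(G) ≤ O_{s'}(G). The quotient by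
P = O_s(G) is σ-soluble by induction, so a Hall–Higman argument gives C_G(P) ≤ P
(`centralizer_piCore_le`).

At most one of the indices is divisible by a prime of s. Each of the other t subgroups contains P,
has trivial O_{s'}, and so lies in 𝔊_s F(s) = F(s) (`mem_of_index_compl`). The Σ_t-closure of F(s)
then puts G itself in F(s), hence also its quotient by O_{s',s}(G). -/

theorem IsPiNumber.of_dvd {π : Set Nat.Primes} {m n : ℕ} (hn : IsPiNumber π n) (h : m ∣ n) :
    IsPiNumber π m :=
  fun p hp => hn p (hp.trans h)

theorem IsPiNumber.mul {π : Set Nat.Primes} {m n : ℕ} (hm : IsPiNumber π m)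
    (hn : IsPiNumber π n) : IsPiNumber π (m * n) :=
  fun p hp => (p.2.dvd_mul.1 hp).elim (hm p) (hn p)

theorem IsPiNumber.mono {π ρ : Set Nat.Primes} (h : π ⊆ ρ) {n : ℕ} (hn : IsPiNumber π n) :
    IsPiNumber ρ n :=
  fun p hp => h (hn p hp)

theorem isPiNumber_one (π : Set Nat.Primes) : IsPiNumber π 1 :=
  fun p hp => absurd hp p.2.not_dvd_one

theorem IsPiNumber.coprime {π : Set Nat.Primes} {m n : ℕ} (hm : IsPiNumber π m)
    (hn : IsPiNumber πᶜ n) : Nat.Coprime m n :=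
  Nat.coprime_of_dvd fun p hp hpm hpn => hn ⟨p, hp⟩ hpn (hm ⟨p, hp⟩ hpm)

theorem IsPiNumber.eq_one {π : Set Nat.Primes} {n : ℕ} (hm : IsPiNumber π n)
    (hn : IsPiNumber πᶜ n) : n = 1 :=
  (Nat.coprime_self n).1 (hm.coprime hn)

theorem IsPiGroup.mono_subgroup {π : Set Nat.Primes} {G : Type u} [Group G]
    {H K : Subgroup G} (hK : IsPiGroup π K) (h : H ≤ K) : IsPiGroup π H :=
  IsPiNumber.of_dvd hK (Subgroup.card_dvd_of_le h)

theorem IsPiGroup.map {π : Set Nat.Primes} {G : Type u} {H : Type v} [Group G] [Group H]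
    {K : Subgroup G} (hK : IsPiGroup π K) (f : G →* H) : IsPiGroup π (K.map f) :=
  IsPiNumber.of_dvd hK (K.card_map_dvd f)

theorem IsPiGroup.subgroupOf {π : Set Nat.Primes} {G : Type u} [Group G]
    {H : Subgroup G} (hH : IsPiGroup π H) (K : Subgroup G) : IsPiGroup π (H.subgroupOf K) := by
  refine IsPiNumber.of_dvd hH ?_
  rw [← Subgroup.card_map_of_injective K.subtype_injective]
  exact Subgroup.card_dvd_of_le (Subgroup.map_comap_le _ _)

theorem isPiGroup_bot (π : Set Nat.Primes) (G : Type u) [Group G] :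
    IsPiGroup π (⊥ : Subgroup G) := by
  unfold IsPiGroup
  rw [Subgroup.card_bot]
  exact isPiNumber_one π

theorem isPiGroup_iff_of_relIndex {π : Set Nat.Primes} {G : Type u} [Group G]
    {H K : Subgroup G} (h : H ≤ K) :
    IsPiGroup π K ↔ IsPiGroup π H ∧ IsPiNumber π (H.relIndex K) := by
  have hc : Nat.card H * H.relIndex K = Nat.card K := by
    rw [← Subgroup.relIndex_bot_left, ← Subgroup.relIndex_bot_left,
      Subgroup.relIndex_mul_relIndex _ _ _ bot_le h]
  unfold IsPiGroup
  rw [← hc]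
  exact ⟨fun hK => ⟨hK.of_dvd (Dvd.intro _ rfl), hK.of_dvd (Dvd.intro_left _ rfl)⟩,
    fun hK => hK.1.mul hK.2⟩

theorem eq_bot_of_isPiGroup {π : Set Nat.Primes} {G : Type u} [Group G]
    {H : Subgroup G} (h : IsPiGroup π H) (h' : IsPiGroup πᶜ H) : H = ⊥ :=
  Subgroup.card_eq_one.1 (IsPiNumber.eq_one h h')

/-! ### `O_π(G)` -/

theorem le_piCore {π : Set Nat.Primes} {G : Type u} [Group G] {N : Subgroup G} [hN : N.Normal]
    (h : IsPiGroup π N) : N ≤ piCore π G :=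
  le_sSup ⟨hN, h⟩

theorem IsPiGroup.sup {π : Set Nat.Primes} {G : Type u} [Group G] {M N : Subgroup G} [M.Normal]
    (hM : IsPiGroup π M) (hN : IsPiGroup π N) : IsPiGroup π (M ⊔ N : Subgroup G) := by
  refine (isPiGroup_iff_of_relIndex le_sup_left).2 ⟨hM, ?_⟩
  rw [Subgroup.relIndex_sup_left]
  exact IsPiNumber.of_dvd hN (Subgroup.relIndex_dvd_card _ _)

theorem isPiGroup_piCore (π : Set Nat.Primes) (G : Type u) [Group G] [Finite G] :
    IsPiGroup π (piCore π G) := by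
  obtain ⟨M, ⟨hM, hMπ⟩, hmax⟩ :=
    (Set.toFinite {N : Subgroup G | N.Normal ∧ IsPiGroup π N}).exists_maximal
      ⟨⊥, inferInstance, isPiGroup_bot π G⟩
  have : piCore π G ≤ M := by
    refine sSup_le ?_
    rintro N ⟨hN, hNπ⟩
    exact le_sup_right.trans (hmax ⟨Subgroup.sup_normal M N, hMπ.sup hNπ⟩ le_sup_left)
  exact hMπ.mono_subgroup this

instance piCore_characteristic (π : Set Nat.Primes) (G : Type u) [Group G] :
    (piCore π G).Characteristic :=
  Subgroup.characteristic_iff_map_eq.2 fun e => piCore_map π e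

/-- A `π`-subgroup that is normal in a normal subgroup of `G` lies in `O_π(G)`. -/
theorem le_piCore_of_le_normalizer {π : Set Nat.Primes} {G : Type u} [Group G] [Finite G]
    {N M : Subgroup G} [M.Normal] (hNM : N ≤ M) (hMN : M ≤ Subgroup.normalizer N)
    (h : IsPiGroup π N) : N ≤ piCore π G := by
  have hn : (N.subgroupOf M).Normal := (Subgroup.normal_subgroupOf_iff_le_normalizer hNM).2 hMN
  have h1 : N.subgroupOf M ≤ piCore π M := le_piCore (h.subgroupOf M)
  -- O_π(M) is characteristic in the normal subgroup M, hence normal in G.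
  have h2 : (piCore π M).map M.subtype ≤ piCore π G :=
    le_piCore ((isPiGroup_piCore π M).map M.subtype)
  have h3 := (Subgroup.map_mono (f := M.subtype) h1).trans h2
  rwa [Subgroup.map_subgroupOf_eq_of_le hNM] at h3

/-! ### `O_{π', π}(G)` -/

theorem piCore_compl_le_piPrimePiCore (π : Set Nat.Primes) (G : Type u) [Group G] :
    piCore πᶜ G ≤ piPrimePiCore π G := by
  unfold piPrimePiCore
  exact (QuotientGroup.ker_mk' (piCore πᶜ G)).symm.le.trans (MonoidHom.ker_le_comap _ _)

theorem isPiNumber_relIndex_piPrimePiCore (π : Set Nat.Primes) (G : Type u) [Group G] [Finite G] :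
    IsPiNumber π ((piCore πᶜ G).relIndex (piPrimePiCore π G)) := by
  have h : (QuotientGroup.mk' (piCore πᶜ G)).ker.relIndex (piPrimePiCore π G)
      ∣ Nat.card (piCore π (G ⧸ piCore πᶜ G)) := by
    rw [Subgroup.relIndex_ker]
    exact Subgroup.card_dvd_of_le (Subgroup.map_comap_le _ _)
  rw [QuotientGroup.ker_mk'] at h
  exact IsPiNumber.of_dvd (isPiGroup_piCore π _) h

/-- A lower bound for O_{π',π}(G) in terms of indices only. K need not lie in U: enlarging K to
O_{π'}(G) replaces the index by a divisor. -/
theorem le_piPrimePiCore {π : Set Nat.Primes} {G : Type u} [Group G]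
    {K U : Subgroup G} [K.Normal] [hU : U.Normal] (hK : IsPiGroup πᶜ K)
    (h : IsPiNumber π (K.relIndex U)) : U ≤ piPrimePiCore π G := by
  unfold piPrimePiCore
  rw [← Subgroup.map_le_iff_le_comap]
  have hn : (U.map (QuotientGroup.mk' (piCore πᶜ G))).Normal :=
    hU.map _ (QuotientGroup.mk'_surjective _)
  refine le_piCore ?_
  unfold IsPiGroup
  rw [← Subgroup.relIndex_ker, QuotientGroup.ker_mk']
  exact h.of_dvd (Subgroup.relIndex_dvd_of_le_left U (le_piCore hK))

/-- The image of O_{π'}(G) is a normal π'-subgroup, and its index in the image of O_{π',π}(G) is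
still a π-number. -/
theorem piPrimePiCore_le_comap (π : Set Nat.Primes) {G : Type u} {H : Type v} [Group G] [Group H]
    [Finite G] {f : G →* H} (hf : Function.Surjective f) :
    piPrimePiCore π G ≤ (piPrimePiCore π H).comap f := by
  rw [← Subgroup.map_le_iff_le_comap]
  have h1 : ((piCore πᶜ G).map f).Normal := (piCore_normal _ _).map f hf
  have h2 : ((piPrimePiCore π G).map f).Normal := (piPrimePiCore_normal _ _).map f hf
  refine le_piPrimePiCore ((isPiGroup_piCore πᶜ G).map f) ?_
  rw [Subgroup.relIndex_map_map]
  refine (isPiNumber_relIndex_piPrimePiCore π G).of_dvd ?_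
  have h3 : piPrimePiCore π G ⊔ f.ker = piPrimePiCore π G ⊔ (piCore πᶜ G ⊔ f.ker) := by
    rw [← sup_assoc, sup_eq_left.2 (piCore_compl_le_piPrimePiCore π G)]
  rw [h3, Subgroup.relIndex_sup_right]
  exact Subgroup.relIndex_dvd_of_le_left _ le_sup_left

theorem comap_piPrimePiCore_le {π : Set Nat.Primes} {G : Type u} [Group G] [Finite G]
    {N : Subgroup G} [N.Normal] (hN : IsPiGroup πᶜ N) :
    (piPrimePiCore π (G ⧸ N)).comap (QuotientGroup.mk' N) ≤ piPrimePiCore π G := by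
  have hs := QuotientGroup.mk'_surjective N
  have h1 : IsPiGroup πᶜ ((piCore πᶜ (G ⧸ N)).comap (QuotientGroup.mk' N)) := by
    have hle : N ≤ (piCore πᶜ (G ⧸ N)).comap (QuotientGroup.mk' N) := by
      conv_lhs => rw [← QuotientGroup.ker_mk' N]
      exact MonoidHom.ker_le_comap _ _
    refine (isPiGroup_iff_of_relIndex hle).2 ⟨hN, ?_⟩
    have h : (QuotientGroup.mk' N).ker.relIndex ((piCore πᶜ (G ⧸ N)).comap (QuotientGroup.mk' N))
        ∣ Nat.card (piCore πᶜ (G ⧸ N)) := by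
      rw [Subgroup.relIndex_ker, Subgroup.map_comap_eq_self_of_surjective hs]
    rw [QuotientGroup.ker_mk'] at h
    exact IsPiNumber.of_dvd (isPiGroup_piCore πᶜ _) h
  refine le_piPrimePiCore h1 ?_
  rw [Subgroup.relIndex_comap, Subgroup.map_comap_eq_self_of_surjective hs]
  exact isPiNumber_relIndex_piPrimePiCore π (G ⧸ N)

/-- If `O_{π'}(G) = 1` then `O_{π', π}(G)` is a `π`-group. -/
theorem isPiGroup_piPrimePiCore {π : Set Nat.Primes} {G : Type u} [Group G] [Finite G]
    (h : piCore πᶜ G = ⊥) : IsPiGroup π (piPrimePiCore π G) := by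
  have := isPiNumber_relIndex_piPrimePiCore π G
  rwa [h, Subgroup.relIndex_bot_left] at this

/-! ### Formations -/

theorem IsFormation.mem_of_surjective {X : GroupClass.{u}} (hX : IsFormation X) {G H : Type u}
    [Group G] [Group H] [Finite G] [Finite H] {f : G →* H} (hf : Function.Surjective f)
    (hG : X.Mem G) : X.Mem H :=
  X.iso (QuotientGroup.quotientKerEquivOfSurjective f hf) (hX.1 G f.ker hG)

theorem LF_mem_of_surjective {σ : Set (Set Nat.Primes)} {F : σ → GroupClass.{u}}
    (hF : IsFormationFunction σ F) {G H : Type u} [Group G] [Group H] [Finite G] [Finite H]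
    {f : G →* H} (hf : Function.Surjective f) (hG : (LF σ F).Mem G) : (LF σ F).Mem H := by
  rcases subsingleton_or_nontrivial H with hH | hH
  · exact Or.inl hH
  rcases hG with hG | ⟨-, hG⟩
  · exact (not_subsingleton H hf.subsingleton).elim
  refine Or.inr ⟨hH, fun s ⟨hs, p, hp, hpH⟩ => ?_⟩
  have hmap : Function.Surjective (QuotientGroup.map (piPrimePiCore (s : Set Nat.Primes) G)
      (piPrimePiCore (s : Set Nat.Primes) H) f (piPrimePiCore_le_comap _ hf)) :=
    QuotientGroup.map_surjective_of_surjective _ _ _ ((QuotientGroup.mk'_surjective _).comp hf) _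
  exact (hF s).mem_of_surjective hmap
    (hG s ⟨hs, p, hp, hpH.trans (Subgroup.card_dvd_of_surjective f hf)⟩)

/-- The local condition at a block `s` may be checked modulo a normal `s'`-subgroup. -/
theorem mem_quotient_piPrimePiCore_of_quotient {σ : Set (Set Nat.Primes)} {F : σ → GroupClass.{u}}
    (hF : IsFormationFunction σ F) {G : Type u} [Group G] [Finite G] {s : σ}
    {N : Subgroup G} [N.Normal] (hN : IsPiGroup (s : Set Nat.Primes)ᶜ N)
    (hs : (s : Set Nat.Primes) ∈ sigmaOf σ (Nat.card G)) (hG : (LF σ F).Mem (G ⧸ N)) :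
    (F s).Mem (G ⧸ piPrimePiCore (s : Set Nat.Primes) G) := by
  obtain ⟨hsσ, p, hp, hpG⟩ := hs
  -- The prime p of s survives in |G/N|, so the condition at s is available for G/N.
  have hpN : (p : ℕ) ∣ Nat.card (G ⧸ N) := by
    rw [← Subgroup.card_mul_index N, Subgroup.index_eq_card] at hpG
    exact (p.2.dvd_mul.1 hpG).resolve_left fun h => hN p h hp
  have hmem : (F s).Mem ((G ⧸ N) ⧸ piPrimePiCore (s : Set Nat.Primes) (G ⧸ N)) := by
    rcases hG with hG | ⟨-, hG⟩
    · have := Nat.card_unique (α := G ⧸ N)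
      rw [this] at hpN
      exact (p.2.not_dvd_one hpN).elim
    · exact hG s ⟨hsσ, p, hp, hpN⟩
  have hle := comap_piPrimePiCore_le hN
  have hNle : N ≤ piPrimePiCore (s : Set Nat.Primes) G :=
    (le_piCore hN).trans (piCore_compl_le_piPrimePiCore _ _)
  -- G/O_{s',s}(G) is a quotient of (G/N)/O_{s',s}(G/N), which lies in F(s).
  let g : G ⧸ N →* G ⧸ piPrimePiCore (s : Set Nat.Primes) G :=
    QuotientGroup.map N _ (MonoidHom.id G) hNle
  have hg : Function.Surjective g :=
    QuotientGroup.map_surjective_of_surjective _ _ (MonoidHom.id G)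
      (QuotientGroup.mk'_surjective (piPrimePiCore (s : Set Nat.Primes) G)) hNle
  have hker : ∀ x ∈ piPrimePiCore (s : Set Nat.Primes) (G ⧸ N), g x = 1 := by
    intro x hx
    obtain ⟨y, rfl⟩ := QuotientGroup.mk'_surjective N x
    exact (QuotientGroup.eq_one_iff y).2 (hle hx)
  refine (hF s).mem_of_surjective (f := QuotientGroup.lift _ g hker) ?_ hmem
  exact QuotientGroup.lift_surjective_of_surjective _ _ hg _

/-! ### Indices -/

/-- Since KH is a subgroup, the product formula gives |K : H ∩ K| = |KH : H|. -/
theorem relIndex_dvd_index_of_normal_right {G : Type u} [Group G] [Finite G] (H K : Subgroup G)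
    [K.Normal] : H.relIndex K ∣ H.index := by
  have h1 : Nat.card (H ⊓ K : Subgroup G) * H.relIndex K = Nat.card K := by
    rw [← Subgroup.inf_relIndex_right, ← Subgroup.relIndex_bot_left, ← Subgroup.relIndex_bot_left,
      Subgroup.relIndex_mul_relIndex _ _ _ bot_le inf_le_right]
  have h2 : Nat.card (H ⊓ K : Subgroup G) * K.relIndex H = Nat.card H := by
    rw [← Subgroup.inf_relIndex_left, ← Subgroup.relIndex_bot_left, ← Subgroup.relIndex_bot_left,
      Subgroup.relIndex_mul_relIndex _ _ _ bot_le inf_le_left]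
  have h3 : Nat.card H * H.relIndex (K ⊔ H) = Nat.card K * K.relIndex H := by
    rw [← Subgroup.relIndex_sup_left H K, ← Subgroup.relIndex_bot_left,
      ← Subgroup.relIndex_bot_left, Subgroup.relIndex_mul_relIndex _ _ _ bot_le le_sup_right,
      Subgroup.relIndex_mul_relIndex _ _ _ bot_le le_sup_left]
  have h4 : K.relIndex H ≠ 0 := fun h => by
    rw [h, mul_zero] at h2
    exact Nat.card_pos.ne h2
  have h5 : H.relIndex K = H.relIndex (K ⊔ H) := by
    rw [← h1, ← h2, mul_right_comm] at h3
    exact (Nat.eq_of_mul_eq_mul_left Nat.card_pos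
      (Nat.eq_of_mul_eq_mul_right (Nat.pos_of_ne_zero h4) h3)).symm
  rw [h5]
  exact Subgroup.relIndex_dvd_index_of_le le_sup_right

/-- Factor |G : A ∩ B| through A and through B; coprimality forces |G : B| to divide |A : A ∩ B|,
which is at most |G : B|. -/
theorem relIndex_eq_index_of_coprime {G : Type u} [Group G] [Finite G] {A B : Subgroup G}
    (h : Nat.Coprime A.index B.index) : B.relIndex A = B.index := by
  have h1 : B.relIndex A * A.index = A.relIndex B * B.index := by
    rw [← Subgroup.inf_relIndex_left, ← Subgroup.inf_relIndex_right A B,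
      Subgroup.relIndex_mul_index inf_le_left, Subgroup.relIndex_mul_index inf_le_right]
  have h2 : B.index ∣ B.relIndex A :=
    h.symm.dvd_of_dvd_mul_right ⟨A.relIndex B, by rw [h1, mul_comm]⟩
  refine le_antisymm ?_ (Nat.le_of_dvd (Nat.pos_of_ne_zero ?_) h2)
  · rw [← Subgroup.relIndex_top_right]
    refine Subgroup.relIndex_le_of_le_right le_top ?_
    rw [Subgroup.relIndex_top_right]
    exact Subgroup.index_ne_zero_of_finite
  · exact Subgroup.index_ne_zero_of_finite

/-- A `π`-subgroup that is normalised by `A` lies in every subgroup whose index is a `π'`-number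
coprime to `|G : A|`. -/
theorem le_of_isPiGroup_of_coprime {π : Set Nat.Primes} {G : Type u} [Group G] [Finite G]
    {A B N : Subgroup G} (hNA : N ≤ A) (hAN : A ≤ Subgroup.normalizer N) (hN : IsPiGroup π N)
    (hB : IsPiNumber πᶜ B.index) (h : Nat.Coprime A.index B.index) : N ≤ B := by
  have hn : (N.subgroupOf A).Normal := (Subgroup.normal_subgroupOf_iff_le_normalizer hNA).2 hAN
  -- |N : N ∩ B| divides |A : A ∩ B| = |G : B|, a π'-number; it also divides the π-number |N|, so it
  -- is 1.
  have h1 : B.relIndex N ∣ B.index := by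
    rw [← relIndex_eq_index_of_coprime h, ← Subgroup.relIndex_subgroupOf hNA]
    exact relIndex_dvd_index_of_normal_right _ _
  exact Subgroup.relIndex_eq_one.1
    (IsPiNumber.eq_one (IsPiNumber.of_dvd hN (Subgroup.relIndex_dvd_card _ _)) (hB.of_dvd h1))

theorem le_of_normal_of_isPiGroup {π : Set Nat.Primes} {G : Type u} [Group G] [Finite G]
    {B N : Subgroup G} [N.Normal] (hN : IsPiGroup π N) (hB : IsPiNumber πᶜ B.index) : N ≤ B :=
  le_of_isPiGroup_of_coprime (A := ⊤) le_top Subgroup.le_normalizer_of_normal hN hB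
    (by simp)

/-! ### `σ`-coprime numbers -/

theorem SigmaCoprime.of_dvd {σ : Set (Set Nat.Primes)} {m n m' n' : ℕ} (h : SigmaCoprime σ m n)
    (hm : m' ∣ m) (hn : n' ∣ n) : SigmaCoprime σ m' n' := by
  refine Set.eq_empty_of_forall_notMem ?_
  rintro s ⟨⟨hs, p, hp, hpm⟩, -, q, hq, hqn⟩
  exact Set.eq_empty_iff_forall_notMem.1 h s
    ⟨⟨hs, p, hp, hpm.trans hm⟩, hs, q, hq, hqn.trans hn⟩

theorem SigmaCoprime.coprime {σ : Set (Set Nat.Primes)} (hσ : Setoid.IsPartition σ) {m n : ℕ}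
    (h : SigmaCoprime σ m n) : Nat.Coprime m n := by
  refine Nat.coprime_of_dvd fun p hp hpm hpn => ?_
  obtain ⟨s, ⟨hs, hps⟩, -⟩ := hσ.2 ⟨p, hp⟩
  exact Set.eq_empty_iff_forall_notMem.1 h s ⟨⟨hs, _, hps, hpm⟩, hs, _, hps, hpn⟩

theorem SigmaCoprime.isPiNumber_compl {σ : Set (Set Nat.Primes)} {m n : ℕ}
    (h : SigmaCoprime σ m n) {s : Set Nat.Primes} (hs : s ∈ σ) (hm : ¬ IsPiNumber sᶜ m) :
    IsPiNumber sᶜ n := by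
  unfold IsPiNumber at hm
  push Not at hm
  obtain ⟨p, hpm, hp⟩ := hm
  exact fun q hqn hq => Set.eq_empty_iff_forall_notMem.1 h s
    ⟨⟨hs, p, Set.notMem_compl_iff.1 hp, hpm⟩, hs, q, hq, hqn⟩

theorem block_subset_compl {σ : Set (Set Nat.Primes)} (hσ : Setoid.IsPartition σ)
    {r s : Set Nat.Primes} (hr : r ∈ σ) (hs : s ∈ σ) (h : r ≠ s) : r ⊆ sᶜ :=
  Set.disjoint_left.1 (hσ.pairwiseDisjoint hr hs h)

/-! ### `σ`-soluble groups -/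

theorem exists_isChiefFactor {G : Type u} [Group G] [Finite G] {K L : Subgroup G}
    [hK : K.Normal] [hL : L.Normal] (h : K < L) : ∃ M, IsChiefFactor K M ∧ M ≤ L := by
  obtain ⟨M, ⟨hM, hKM, hML⟩, hmin⟩ :=
    (Set.toFinite {M : Subgroup G | M.Normal ∧ K < M ∧ M ≤ L}).exists_minimal ⟨L, hL, h, le_rfl⟩
  refine ⟨M, ⟨hK, hM, hKM, fun N hN hKN hNM => ?_⟩, hML⟩
  rcases hKN.eq_or_lt with h | h
  · exact Or.inl h.symm
  · exact Or.inr (le_antisymm hNM (hmin ⟨hN, h, hNM.trans hML⟩ hNM))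

theorem IsSigmaSoluble.exists_normal_isPiGroup {σ : Set (Set Nat.Primes)} {G : Type u} [Group G]
    [Finite G] (hG : IsSigmaSoluble σ G) {M : Subgroup G} [M.Normal] (hM : M ≠ ⊥) :
    ∃ r ∈ σ, ∃ N : Subgroup G, N.Normal ∧ N ≤ M ∧ N ≠ ⊥ ∧ IsPiGroup r N := by
  obtain ⟨N, hN, hNM⟩ := exists_isChiefFactor (bot_lt_iff_ne_bot.2 hM)
  obtain ⟨r, hr, hr'⟩ := hG ⊥ N hN
  refine ⟨r, hr, N, hN.2.1, hNM, hN.2.2.1.ne', ?_⟩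
  have : Nat.card (N ⧸ (⊥ : Subgroup G).subgroupOf N) = Nat.card N := by
    rw [← Subgroup.index_eq_card, ← Subgroup.relIndex_bot_left]
    rfl
  unfold IsPiGroup at hr' ⊢
  rwa [this] at hr'

/-- Hall–Higman. If C = C_G(P) is not inside P = O_s(G), then CP/P contains a nontrivial normal
r-subgroup N of G/P, with preimage K. If r = s, K is a normal s-subgroup exceeding P. Otherwise D =
C ∩ K covers N, and D ∩ P is a central s-subgroup of D with s'-index. A Schur–Zassenhaus complement
Q is then normal in D, so Q ≤ O_{s'}(G) = 1 and D ≤ P, a contradiction. -/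
theorem centralizer_piCore_le {σ : Set (Set Nat.Primes)} (hσ : Setoid.IsPartition σ)
    {s : Set Nat.Primes} (hs : s ∈ σ) {G : Type u} [Group G] [Finite G] (hG : piCore sᶜ G = ⊥)
    (hsol : IsSigmaSoluble σ (G ⧸ piCore s G)) :
    Subgroup.centralizer (piCore s G : Set G) ≤ piCore s G := by
  by_contra hC
  set P := piCore s G with hP
  set C := Subgroup.centralizer (P : Set G) with hCdef
  have hCn : C.Normal := Subgroup.normal_centralizer
  have hsurj := QuotientGroup.mk'_surjective P
  have hLn : (C.map (QuotientGroup.mk' P)).Normal := hCn.map _ hsurj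
  have hL : C.map (QuotientGroup.mk' P) ≠ ⊥ := by
    rwa [Ne, Subgroup.map_eq_bot_iff, QuotientGroup.ker_mk']
  obtain ⟨r, hr, N, hN, hNL, hNbot, hNr⟩ := hsol.exists_normal_isPiGroup hL
  have hrel : ∀ D : Subgroup G, P.relIndex D = Nat.card (D.map (QuotientGroup.mk' P)) := by
    intro D
    rw [← Subgroup.relIndex_ker, QuotientGroup.ker_mk']
  set K := N.comap (QuotientGroup.mk' P) with hK
  have hKN : K.map (QuotientGroup.mk' P) = N := Subgroup.map_comap_eq_self_of_surjective hsurj N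
  have hKn : K.Normal := hN.comap _
  have hPK : P ≤ K := by
    conv_lhs => rw [← QuotientGroup.ker_mk' P]
    exact MonoidHom.ker_le_comap _ _
  by_cases hrs : r = s
  · subst hrs
    have hKr : IsPiGroup r K := by
      refine (isPiGroup_iff_of_relIndex hPK).2 ⟨isPiGroup_piCore _ _, ?_⟩
      rw [hrel, hKN]
      exact hNr
    apply hNbot
    rw [← hKN, Subgroup.map_eq_bot_iff, QuotientGroup.ker_mk']
    exact le_piCore hKr
  have hNs : IsPiGroup sᶜ N := IsPiNumber.mono (block_subset_compl hσ hr hs hrs) hNr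
  set D := C ⊓ K with hD
  have hDN : D.map (QuotientGroup.mk' P) ≤ N := hKN ▸ Subgroup.map_mono inf_le_right
  have hND : N ≤ D.map (QuotientGroup.mk' P) := by
    intro x hx
    obtain ⟨c, hc, rfl⟩ := hNL hx
    exact ⟨c, ⟨hc, hx⟩, rfl⟩
  have hZ : IsPiGroup s (P.subgroupOf D) := (isPiGroup_piCore s G).subgroupOf D
  have hZi : IsPiNumber sᶜ (P.subgroupOf D).index := by
    change IsPiNumber sᶜ (P.relIndex D)
    rw [hrel]
    exact hNs.mono_subgroup hDN
  obtain ⟨Q, hQ⟩ := Subgroup.exists_right_complement'_of_coprime (IsPiNumber.coprime hZ hZi)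
  have hQs : IsPiGroup sᶜ Q := by
    unfold IsPiGroup
    rwa [← hQ.symm.index_eq_card]
  have hQn : Q.Normal := by
    refine ⟨fun q hq d => ?_⟩
    obtain ⟨⟨⟨z, hz⟩, ⟨a, ha⟩⟩, rfl⟩ := hQ.2 d
    have hcomm : ∀ x : D, z * x = x * z := fun x =>
      Subtype.ext (Subgroup.mem_centralizer_iff.1 x.2.1 _ (Subgroup.mem_subgroupOf.1 hz))
    have : z * a * q * (z * a)⁻¹ = a * q * a⁻¹ := by
      calc z * a * q * (z * a)⁻¹ = z * (a * q * a⁻¹) * z⁻¹ := by group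
        _ = a * q * a⁻¹ := by rw [hcomm, mul_inv_cancel_right]
    change z * a * q * (z * a)⁻¹ ∈ Q
    rw [this]
    exact Q.mul_mem (Q.mul_mem ha hq) (Q.inv_mem ha)
  have hQ' : Q.map D.subtype ≤ piCore sᶜ G := by
    refine le_piCore_of_le_normalizer (M := D) (Subgroup.map_subtype_le Q) ?_ (hQs.map _)
    rw [← Subgroup.normal_subgroupOf_iff_le_normalizer (Subgroup.map_subtype_le Q),
      Subgroup.subgroupOf,
      Subgroup.comap_map_eq_self_of_injective (Subgroup.subtype_injective _)]
    exact hQn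
  rw [hG, le_bot_iff, Subgroup.map_eq_bot_iff_of_injective _ D.subtype_injective] at hQ'
  subst hQ'
  have hDP : D ≤ P := by
    rw [← Subgroup.subgroupOf_eq_top]
    exact Subgroup.isComplement'_bot_right.1 hQ
  apply hNbot
  rw [← le_bot_iff]
  refine hND.trans ?_
  rw [le_bot_iff, Subgroup.map_eq_bot_iff, QuotientGroup.ker_mk']
  exact hDP

/-- A nontrivial group with three `σ`-soluble subgroups of pairwise `σ`-coprime indices has a
nontrivial normal `σ`-primary subgroup. -/
theorem exists_piCore_ne_bot {σ : Set (Set Nat.Primes)} (hσ : Setoid.IsPartition σ)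
    {G : Type u} [Group G] [Finite G] [Nontrivial G] {A B C : Subgroup G}
    (hA : IsSigmaSoluble σ A) (hB : IsSigmaSoluble σ B) (hC : IsSigmaSoluble σ C)
    (hAB : SigmaCoprime σ A.index B.index) (hAC : SigmaCoprime σ A.index C.index)
    (hBC : SigmaCoprime σ B.index C.index) : ∃ r ∈ σ, piCore r G ≠ ⊥ := by
  -- A normal s-subgroup N of A lies in every conjugate of E, because each has the same s'-index
  -- coprime to |G : A|. So the core of E is nontrivial and contains a nontrivial r-subgroup normal
  -- in E; being normal in the core, it lies in O_r(G).
  have key : ∀ (E N : Subgroup G) (s : Set Nat.Primes), IsSigmaSoluble σ E → N ≤ A →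
      A ≤ Subgroup.normalizer N → N ≠ ⊥ → IsPiGroup s N → IsPiNumber sᶜ E.index →
      Nat.Coprime A.index E.index → ∃ r ∈ σ, piCore r G ≠ ⊥ := by
    intro E N s hE hNA hAN hNbot hNs hEs hAE
    have hNcore : N ≤ E.normalCore := by
      intro n hn g
      have hi : (E.comap (MulAut.conj g).toMonoidHom).index = E.index :=
        Subgroup.index_comap_of_surjective E (MulAut.conj g).surjective
      exact le_of_isPiGroup_of_coprime (B := E.comap (MulAut.conj g).toMonoidHom) hNA hAN hNs
        (by rwa [hi]) (by rwa [hi]) hn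
    have hMbot : E.normalCore.subgroupOf E ≠ ⊥ := by
      rw [Ne, Subgroup.subgroupOf_eq_bot, Subgroup.disjoint_def]
      intro h
      exact hNbot ((Subgroup.eq_bot_iff_forall N).2 fun n hn =>
        h (hNcore hn) (E.normalCore_le (hNcore hn)))
    obtain ⟨r, hr, R, hR, hRM, hRbot, hRr⟩ := hE.exists_normal_isPiGroup hMbot
    refine ⟨r, hr, fun h => hRbot ?_⟩
    have hRE : R.map E.subtype ≤ E.normalCore := Subgroup.map_le_iff_le_comap.2 hRM
    have hER : E ≤ Subgroup.normalizer (R.map E.subtype : Subgroup G) := by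
      rw [← Subgroup.normal_subgroupOf_iff_le_normalizer (Subgroup.map_subtype_le R),
        Subgroup.subgroupOf,
      Subgroup.comap_map_eq_self_of_injective (Subgroup.subtype_injective _)]
      exact hR
    have := le_piCore_of_le_normalizer hRE (E.normalCore_le.trans hER) (hRr.map E.subtype)
    rwa [h, le_bot_iff, Subgroup.map_eq_bot_iff_of_injective _ E.subtype_injective] at this
  -- If A = 1, then |G : B| divides |G| = |G : A| and is coprime to it, so B = G is itself
  -- σ-soluble.
  rcases eq_or_ne A ⊥ with rfl | hAbot
  · have hB1 : B = ⊤ := by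
      rw [← Subgroup.index_eq_one]
      refine Nat.Coprime.eq_one_of_dvd (hAB.coprime hσ).symm ?_
      rw [Subgroup.index_bot]
      exact B.index_dvd_card
    subst hB1
    obtain ⟨r, hr, R, hR, -, hRbot, hRr⟩ :=
      hB.exists_normal_isPiGroup (M := ⊤) (bot_ne_top (α := Subgroup (⊤ : Subgroup G))).symm
    refine ⟨r, hr, fun h => hRbot ?_⟩
    have hn : (R.map (⊤ : Subgroup G).subtype).Normal :=
      hR.map _ fun g => ⟨⟨g, Subgroup.mem_top g⟩, rfl⟩
    have := le_piCore (hRr.map (⊤ : Subgroup G).subtype)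
    rwa [h, le_bot_iff, Subgroup.map_eq_bot_iff_of_injective _ (Subgroup.subtype_injective _)]
      at this
  have : Nontrivial A := (Subgroup.nontrivial_iff_ne_bot A).2 hAbot
  obtain ⟨s, hs, N, hN, -, hNbot, hNs⟩ :=
    hA.exists_normal_isPiGroup (M := ⊤) (bot_ne_top (α := Subgroup A)).symm
  have hNA : N.map A.subtype ≤ A := Subgroup.map_subtype_le N
  have hAN : A ≤ Subgroup.normalizer (N.map A.subtype : Subgroup G) := by
    rw [← Subgroup.normal_subgroupOf_iff_le_normalizer hNA, Subgroup.subgroupOf,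
      Subgroup.comap_map_eq_self_of_injective (Subgroup.subtype_injective _)]
    exact hN
  have hNbot' : N.map A.subtype ≠ ⊥ := by
    rwa [Ne, Subgroup.map_eq_bot_iff_of_injective _ A.subtype_injective]
  -- At most one of |G : B| and |G : C| is divisible by a prime of s; the other subgroup serves as
  -- E.
  by_cases hBs : IsPiNumber sᶜ B.index
  · exact key B _ s hB hNA hAN hNbot' (hNs.map _) hBs (hAB.coprime hσ)
  · exact key C _ s hC hNA hAN hNbot' (hNs.map _) (hBC.isPiNumber_compl hs hBs) (hAC.coprime hσ)

/-! ### Closure of `LF_σ(F)` -/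

/-- A subgroup in `LF_σ(F)` of `s'`-index in a group with `O_{s'}(G) = 1`, where `O_s(G) ≠ 1`
contains its centralizer, lies in `F(s)`. -/
theorem mem_of_index_compl {σ : Set (Set Nat.Primes)} {F : σ → GroupClass.{u}}
    (hfull : IsFull σ F) (s : σ) {G : Type u} [Group G] [Finite G]
    (hP : piCore (s : Set Nat.Primes) G ≠ ⊥)
    (hC : Subgroup.centralizer (piCore (s : Set Nat.Primes) G : Set G) ≤ piCore s G)
    {A : Subgroup G} (hA : (LF σ F).Mem A) (hAs : IsPiNumber (s : Set Nat.Primes)ᶜ A.index) :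
    (F s).Mem A := by
  set P := piCore (s : Set Nat.Primes) G with hPdef
  have hPs : IsPiGroup (s : Set Nat.Primes) P := isPiGroup_piCore _ _
  have hPA : P ≤ A := le_of_normal_of_isPiGroup hPs hAs
  obtain ⟨p, hp, hpP⟩ : ∃ p : Nat.Primes, p ∈ (s : Set Nat.Primes) ∧ (p : ℕ) ∣ Nat.card P := by
    obtain ⟨p, hp, hpP⟩ := Nat.exists_prime_and_dvd (mt Subgroup.card_eq_one.1 hP)
    exact ⟨⟨p, hp⟩, hPs ⟨p, hp⟩ hpP, hpP⟩
  have hpA : (p : ℕ) ∣ Nat.card A := hpP.trans (Subgroup.card_dvd_of_le hPA)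
  -- O_{s'}(A) and P are normal in A of coprime orders, so they commute; thus O_{s'}(A) ≤ C_G(P) ≤ P
  -- is both an s-group and an s'-group.
  have hcore : piCore (s : Set Nat.Primes)ᶜ A = ⊥ := by
    set R := piCore (s : Set Nat.Primes)ᶜ A with hR
    have hRs : IsPiGroup (s : Set Nat.Primes)ᶜ R := isPiGroup_piCore _ _
    have hPn : (P.subgroupOf A).Normal := inferInstance
    have hdisj : Disjoint R (P.subgroupOf A) := Subgroup.disjoint_of_coprime_natCard
      (IsPiNumber.coprime (hPs.subgroupOf A) hRs).symm
    have hRC : R.map A.subtype ≤ Subgroup.centralizer (P : Set G) := by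
      rintro _ ⟨x, hx, rfl⟩
      rw [Subgroup.mem_centralizer_iff]
      intro y hy
      have := Subgroup.commute_of_normal_of_disjoint R (P.subgroupOf A) inferInstance hPn hdisj x
        ⟨y, hPA hy⟩ hx hy
      exact (congrArg A.subtype this.eq).symm
    have h := eq_bot_of_isPiGroup (hPs.mono_subgroup (hRC.trans hC)) (hRs.map A.subtype)
    rwa [Subgroup.map_eq_bot_iff_of_injective _ A.subtype_injective] at h
  rw [hfull s]
  refine ⟨piPrimePiCore (s : Set Nat.Primes) A, inferInstance, isPiGroup_piPrimePiCore hcore, ?_⟩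
  rcases hA with hA | ⟨-, hA⟩
  · rw [Nat.card_unique] at hpA
    exact (p.2.not_dvd_one hpA).elim
  · exact hA s ⟨s.2, p, hp, hpA⟩

theorem LF_isSigmaClosed {σ : Set (Set Nat.Primes)} (hσ : Setoid.IsPartition σ)
    {t : ℕ} (ht : 1 < t) {F : σ → GroupClass.{u}} (hF : IsFormationFunction σ F)
    (hfull : IsFull σ F)
    (hsol : ∀ (G : Type u) [Group G] [Finite G], (LF σ F).Mem G → IsSigmaSoluble σ G)
    (hclosed : ∀ s : σ, IsSigmaClosed σ t (F s)) : IsSigmaClosed σ (t + 1) (LF σ F) := by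
  intro G _ _ A hA hcop
  induction hn : Nat.card G using Nat.strong_induction_on generalizing G with
  | _ n ih =>
  rcases subsingleton_or_nontrivial G with hG | hG
  · exact Or.inl hG
  have hquot : ∀ (K : Subgroup G) [K.Normal], K ≠ ⊥ → (LF σ F).Mem (G ⧸ K) := by
    intro K _ hKbot
    have hsurj := QuotientGroup.mk'_surjective K
    refine ih (Nat.card (G ⧸ K)) ?_ (G ⧸ K) (fun i => (A i).map (QuotientGroup.mk' K))
      (fun i => ?_) (fun i j hij => ?_) rfl
    · rw [← hn, ← Subgroup.index_eq_card, ← Subgroup.card_mul_index K]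
      exact lt_mul_of_one_lt_left (Nat.pos_of_ne_zero Subgroup.index_ne_zero_of_finite)
        ((Subgroup.one_lt_card_iff_ne_bot K).2 hKbot)
    · exact LF_mem_of_surjective hF ((QuotientGroup.mk' K).subgroupMap_surjective (A i)) (hA i)
    · exact (hcop i j hij).of_dvd (Subgroup.index_map_dvd _ hsurj) (Subgroup.index_map_dvd _ hsurj)
  refine Or.inr ⟨hG, fun s hs => ?_⟩
  by_cases hcore : piCore (s : Set Nat.Primes)ᶜ G = ⊥
  swap
  · exact mem_quotient_piPrimePiCore_of_quotient hF (isPiGroup_piCore _ _) hs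
      (hquot _ hcore)
  obtain ⟨r, hr, hrbot⟩ := exists_piCore_ne_bot hσ (A := A ⟨0, by lia⟩) (B := A ⟨1, by lia⟩)
    (C := A ⟨2, by lia⟩) (hsol _ (hA _)) (hsol _ (hA _)) (hsol _ (hA _))
    (hcop _ _ (by simp)) (hcop _ _ (by simp)) (hcop _ _ (by simp))
  have hrs : r = s := by
    by_contra hrs
    have := le_piCore (IsPiNumber.mono (block_subset_compl hσ hr s.2 hrs) (isPiGroup_piCore r G))
    rw [hcore, le_bot_iff] at this
    exact hrbot this
  subst hrs
  have hC := centralizer_piCore_le hσ s.2 hcore (hsol _ (hquot _ hrbot))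
  -- i₀ is the one subgroup to discard; if all indices are s'-numbers, any choice works.
  obtain ⟨i₀, hi₀⟩ : ∃ i₀, ∀ i, i ≠ i₀ → IsPiNumber (s : Set Nat.Primes)ᶜ (A i).index := by
    by_cases h : ∃ i₀, ¬ IsPiNumber (s : Set Nat.Primes)ᶜ (A i₀).index
    · obtain ⟨i₀, h⟩ := h
      exact ⟨i₀, fun i hi => (hcop i₀ i hi.symm).isPiNumber_compl s.2 h⟩
    · push Not at h
      exact ⟨0, fun i _ => h i⟩
  -- `i₀.succAbove` enumerates the t subgroups other than `A i₀`.
  refine (hF s).mem_of_surjective (QuotientGroup.mk'_surjective _)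
    (hclosed s G (fun j => A (i₀.succAbove j)) (fun j => ?_) fun j k hjk => ?_)
  · exact mem_of_index_compl hfull s hrbot hC (hA _) (hi₀ _ (Fin.succAbove_ne i₀ j))
  · exact hcop _ _ (Fin.succAbove_right_injective.ne hjk)

end SigmaFormation

theorem theorem3p5 (σ : Set (Set Nat.Primes)) (hσ : Setoid.IsPartition σ)
    (t : ℕ) (ht : 1 < t)
    (X : SigmaFormation.GroupClass.{u}) (F : σ → SigmaFormation.GroupClass.{u})
    (hF : SigmaFormation.IsCanonicalDefinition σ F X)
    (hsol : ∀ (G : Type u) [Group G] [Finite G], X.Mem G → SigmaFormation.IsSigmaSoluble σ G)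
    (hclosed : ∀ s : σ, SigmaFormation.IsSigmaClosed σ t (F s)) :
    SigmaFormation.IsSigmaClosed σ (t + 1) X := by
  obtain ⟨hform, rfl, -, hfull⟩ := hF
  exact SigmaFormation.LF_isSigmaClosed hσ ht hform hfull hsol hclosed
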